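/- Let $\mathfrak A$ be a unital $\mathrm C^*$-algebra and let $\Delta$ be a set of irreducible $*$-representations of $\mathfrak A$ on Hilbert spaces which is separating for $\mathfrak A$, that is, such that $\bigoplus_{\sigma\in\Delta}\sigma$ is injective on $\mathfrak A$. For irreducible $*$-representations $\sigma,\pi$ of $\mathfrak A$ write $\sigma\sim\pi$ (weak equivalence) if $\ker\sigma=\ker\pi$. Assume that there are a positive element $t\in\mathfrak A$ and a finite-dimensional $\pi\in\Delta$ such that \[ \min\operatorname{spec}(\pi(t))>\sup_{\sigma\in\Delta,\ \sigma\not\sim\pi}\|\sigma(t)\| . \] Then the support projection $\mathfrak s_\pi$ of $\pi$ lies in $\mathfrak A$ and peaks strongly at $\pi$. Here $\mathfrak s_\pi=1-\mathfrak e_\pi\in\mathfrak A^{**}$, where $\mathfrak e_\pi$ is the unique central projection of the bidual $\mathrm C^*$-algebra $\mathfrak A^{**}$ with $\mathfrak e_\pi\mathfrak A^{**}=\ker\pi^{**}$ (and $\mathfrak A$ is regarded as a subalgebra of $\mathfrak A^{**}$ through the canonical embedding). That an element $T\in\mathfrak A$ peaks strongly at $\pi$ means that \[ \|\pi(T)\|>\sup_{\sigma}\|\sigma(T)\|,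 \] where $\sigma$ ranges over all irreducible $*$-representations of $\mathfrak A$ that are not unitarily equivalent to $\pi$. The supremum over an empty set of representations is understood to be $0$. -/

import Mathlib

universe u v w

noncomputable section

namespace CStarPeak

section Bidual

/-- The bidual `A**` of a normed space. -/
abbrev Bidual (A : Type u) [NormedAddCommGroup A] [NormedSpace ℂ A] : Type u :=
  StrongDual ℂ (StrongDual ℂ A)

/-- The canonical embedding `A → A**`, evaluation at `a`. -/
abbrev toBidual (A : Type u) [NormedAddCommGroup A] [NormedSpace ℂ A] : A →L[ℂ] Bidual A :=
  NormedSpace.inclusionInDoubleDual ℂ A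

/-- The second adjoint `T** : E** → F**` of a bounded linear map, `(T** x)(ψ) = x(ψ ∘ T)`. -/
def secondAdjoint {E : Type u} {F : Type v} [NormedAddCommGroup E] [NormedSpace ℂ E]
    [NormedAddCommGroup F] [NormedSpace ℂ F] (T : E →L[ℂ] F) (x : Bidual E) : Bidual F :=
  x.comp (ContinuousLinearMap.precomp ℂ T)

variable {A : Type u} [CStarAlgebra A]

/-- The functional `y · φ` on `A`, `(y · φ)(a) = y(b ↦ φ(a * b))`, as a bounded linear
function of `φ`. -/
def bidualAct (y : Bidual A) : StrongDual ℂ A →L[ℂ] StrongDual ℂ A :=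
  (ContinuousLinearMap.compL ℂ A (StrongDual ℂ A) ℂ y).comp
    (((ContinuousLinearMap.compL ℂ A (A →L[ℂ] A) (StrongDual ℂ A)).flip
      (ContinuousLinearMap.mul ℂ A)).comp (ContinuousLinearMap.compL ℂ A A ℂ))

theorem bidualAct_apply (y : Bidual A) (φ : StrongDual ℂ A) (a : A) :
    bidualAct y φ a = y (φ.comp (ContinuousLinearMap.mul ℂ A a)) := rfl

/-- The (Arens) product of the bidual C*-algebra: `(x * y)(φ) = x(y · φ)`. -/
instance : Mul (Bidual A) := ⟨fun x y => x.comp (bidualAct y)⟩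

theorem bidual_mul_apply (x y : Bidual A) (φ : StrongDual ℂ A) :
    (x * y) φ = x (bidualAct y φ) := rfl

theorem toBidual_mul (a b : A) : toBidual A (a * b) = toBidual A a * toBidual A b := rfl

/-- The adjoint functional `φ*(a) = conj (φ (a*))`. -/
def dualStar (φ : StrongDual ℂ A) : StrongDual ℂ A :=
  ((starL ℂ : ℂ ≃L⋆[ℂ] ℂ) : ℂ →L⋆[ℂ] ℂ).comp (φ.comp ((starL ℂ : A ≃L⋆[ℂ] A) : A →L⋆[ℂ] A))

theorem dualStar_apply (φ : StrongDual ℂ A) (a : A) : dualStar φ a = star (φ (star a)) := rfl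

theorem norm_dualStar_le (φ : StrongDual ℂ A) : ‖dualStar φ‖ ≤ ‖φ‖ := by
  refine ContinuousLinearMap.opNorm_le_bound _ (norm_nonneg _) fun a => ?_
  rw [dualStar_apply, norm_star]
  simpa using φ.le_opNorm (star a)

/-- The involution of the bidual C*-algebra: `x*(φ) = conj (x (φ*))`. -/
instance : Star (Bidual A) :=
  ⟨fun x => LinearMap.mkContinuous
    { toFun := fun φ => star (x (dualStar φ))
      map_add' := fun φ ψ => by
        have h : dualStar (φ + ψ) = dualStar φ + dualStar ψ := by
          ext a; simp [dualStar_apply]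
        rw [h, map_add, star_add]
      map_smul' := fun c φ => by
        have h : dualStar (c • φ) = star c • dualStar φ := by
          ext a; simp [dualStar_apply]
        rw [h, map_smul]; simp }
    ‖x‖ fun φ => by
      change ‖star (x (dualStar φ))‖ ≤ ‖x‖ * ‖φ‖
      rw [norm_star]
      exact (x.le_opNorm _).trans
        (mul_le_mul_of_nonneg_left (norm_dualStar_le φ) (norm_nonneg x))⟩

theorem bidual_star_apply (x : Bidual A) (φ : StrongDual ℂ A) :
    (star x) φ = star (x (dualStar φ)) := rfl

end Bidual

/-- A (unital) `*`-representation of the unital C*-algebra `A` on a Hilbert space. -/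
structure Rep (A : Type u) [CStarAlgebra A] where
  H : Type v
  [normedAddCommGroup : NormedAddCommGroup H]
  [innerProductSpace : InnerProductSpace ℂ H]
  [completeSpace : CompleteSpace H]
  hom : A →⋆ₐ[ℂ] (H →L[ℂ] H)

attribute [instance] Rep.normedAddCommGroup Rep.innerProductSpace Rep.completeSpace

namespace Rep

variable {A : Type u} [CStarAlgebra A]

/-- Irreducibility: the space is nonzero and has no closed invariant subspaces but `0` and
itself. -/
def IsIrreducible (π : Rep.{u, v} A) : Prop :=
  Nontrivial π.H ∧ ∀ K : Submodule ℂ π.H, IsClosed (K : Set π.H) →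
    (∀ a : A, ∀ ξ ∈ K, π.hom a ξ ∈ K) → K = ⊥ ∨ K = ⊤

/-- `σ` is weakly contained in `π`: `ker π ⊆ ker σ`. -/
def WeaklyContained (σ : Rep.{u, v} A) (π : Rep.{u, w} A) : Prop :=
  RingHom.ker π.hom ≤ RingHom.ker σ.hom

/-- Weak equivalence: each of the two is weakly contained in the other. -/
def WeaklyEquivalent (σ : Rep.{u, v} A) (π : Rep.{u, w} A) : Prop :=
  σ.WeaklyContained π ∧ π.WeaklyContained σ

/-- Unitary equivalence. -/
def UnitarilyEquivalent (σ : Rep.{u, v} A) (π : Rep.{u, w} A) : Prop :=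
  ∃ U : σ.H ≃ₗᵢ[ℂ] π.H, ∀ (a : A) (ξ : σ.H), U (σ.hom a ξ) = π.hom a (U ξ)

/-- A set of representations is separating if the direct sum of its members is injective,
i.e. if `a ↦ (σ(a))_σ` is injective. -/
def Separating (Δ : Set (Rep.{u, v} A)) : Prop :=
  Function.Injective fun (a : A) (σ : Δ) => σ.1.hom a

/-- The representation as a bounded linear map into the bounded operators. -/
def toCLM (π : Rep.{u, v} A) : A →L[ℂ] (π.H →L[ℂ] π.H) :=
  LinearMap.mkContinuous (π.hom : A →ₗ[ℂ] (π.H →L[ℂ] π.H)) 1 fun a => by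
    simpa using NonUnitalStarAlgHom.norm_apply_le π.hom a

theorem toCLM_apply (π : Rep.{u, v} A) (a : A) : π.toCLM a = π.hom a := rfl

/-- `s ∈ A**` is the support projection of `π`: it is `1 - e`, where `e` is the central projection
of `A**` with `e A** = ker π**`. -/
def IsSupportProjection (π : Rep.{u, v} A) (s : Bidual A) : Prop :=
  ∃ e : Bidual A, IsStarProjection e ∧ (∀ x : Bidual A, Commute e x) ∧
    Set.range (fun x : Bidual A => e * x) = {x : Bidual A | secondAdjoint π.toCLM x = 0} ∧
    s = toBidual A 1 - e

/-- `T ∈ A` peaks strongly at `π`: `‖π(T)‖` exceeds the supremum of the `‖σ(T)‖` over the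
irreducible representations `σ` not unitarily equivalent to `π`.  These numbers lie in
`[0, ‖T‖]`, and the supremum is `0` if there is no such `σ`.  Here `σ` acts on a Hilbert space in
the universe `w`; for `w = u` this meets every unitary equivalence class of irreducible
representations of `A`. -/
def PeaksStrongly (T : A) (π : Rep.{u, v} A) : Prop :=
  sSup {r : ℝ | ∃ σ : Rep.{u, w} A, σ.IsIrreducible ∧ ¬ σ.UnitarilyEquivalent π ∧
    r = ‖σ.hom T‖} < ‖π.hom T‖

end Rep

end CStarPeak

end

/-!
The functional calculus turns `t` into a projection `p` of `A`: for a continuous `f : ℝ → ℝ` that is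
`0` up to the supremum of the norms `‖σ(t)‖`, `σ ≁ π`, and `1` from `min spec (π(t))` on, the
element `p = f(t)` satisfies `π(p) = 1` and `σ(p) = 0` for all `σ ≁ π` in `Δ`. Since `Δ` is
separating, an element of `A` is determined by its images under `π` and under the `σ ≁ π`. Hence
`p` is a central projection and annihilates `ker π`, that is, `ker π = (1 - p) A`
(`Rep.exists_central_projection`).

An irreducible representation `σ` sends the central projection `p` to `0` or `1`
(`Rep.IsIrreducible.map_eq_zero_or_eq_one`). In the second case `ker π ⊆ ker σ`, because
`p` annihilates `ker π`. As `π` is finite-dimensional and irreducible, it maps onto all operators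
(`Rep.IsIrreducible.surjective`, from Schur's lemma and the density theorem), and so `σ` is
unitarily equivalent to `π` (`Rep.unitarilyEquivalent_of_weaklyContained`). Therefore `σ(p) = 0`
for every irreducible `σ` not equivalent to `π`, while `‖π(p)‖ = 1`.

In the bidual, `1 - p` is still a central projection, and it generates `ker π**`: a functional
`φ(p ·)` vanishes on `ker π`, so it factors through the finite-dimensional algebra of operators on
the space of `π` (`Rep.isSupportProjection_toBidual`). A central projection is determined by the
ideal that it generates, so the support projection is `p` and nothing else.
-/

namespace CStarPeak

/-! ### The Arens product -/

section Arens

variable {A : Type u} [CStarAlgebra A]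

theorem bidual_mul_assoc (x y z : Bidual A) : x * y * z = x * (y * z) := by
  ext φ
  change x (bidualAct y (bidualAct z φ)) = x (bidualAct (y * z) φ)
  congr 1
  ext a
  rw [bidualAct_apply, bidualAct_apply, bidual_mul_apply]
  congr 1
  ext b
  simp only [bidualAct_apply, ContinuousLinearMap.comp_apply, ContinuousLinearMap.mul_apply']
  congr 1
  ext c
  simp [mul_assoc]

theorem toBidual_mul_apply (a : A) (x : Bidual A) (φ : StrongDual ℂ A) :
    (toBidual A a * x) φ = x (φ.comp (ContinuousLinearMap.mul ℂ A a)) := rfl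

theorem toBidual_one_sub_mul (p : A) (x : Bidual A) :
    toBidual A (1 - p) * x = x - toBidual A p * x := by
  ext φ
  rw [sub_apply, toBidual_mul_apply, toBidual_mul_apply, ← map_sub]
  congr 1
  ext b
  simp

theorem star_toBidual (a : A) : star (toBidual A a) = toBidual A (star a) := by
  ext φ
  rw [bidual_star_apply]
  simp [dualStar_apply]

/-- Central elements of `A` stay central in the bidual. -/
theorem commute_toBidual {a : A} (ha : ∀ b, Commute a b) (x : Bidual A) :
    Commute (toBidual A a) x := by
  ext φ
  rw [toBidual_mul_apply, bidual_mul_apply]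
  congr 1
  ext b
  simp [bidualAct_apply, (ha b).eq]

theorem isStarProjection_toBidual {p : A} (hp : IsStarProjection p) :
    IsStarProjection (toBidual A p) where
  isIdempotentElem := by
    rw [IsIdempotentElem, ← toBidual_mul, hp.isIdempotentElem.eq]
  isSelfAdjoint := by
    rw [isSelfAdjoint_iff, star_toBidual, hp.isSelfAdjoint.star_eq]

/-- Commuting idempotents of the bidual that generate the same right ideal coincide. -/
theorem bidual_idempotent_ext {e f : Bidual A} (he : IsIdempotentElem e) (hf : IsIdempotentElem f)
    (hcomm : Commute e f) (h : Set.range (fun x => e * x) = Set.range (fun x => f * x)) :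
    e = f := by
  have key : ∀ {e f : Bidual A}, IsIdempotentElem e → IsIdempotentElem f →
      Set.range (fun x => e * x) = Set.range (fun x => f * x) → f * e = e := by
    intro e f he hf h
    obtain ⟨y, hy : f * y = e⟩ : e ∈ Set.range (fun x => f * x) := h ▸ ⟨e, he⟩
    rw [← hy, ← bidual_mul_assoc, hf.eq]
  rw [← key he hf h, ← hcomm.eq, key hf he h.symm]

end Arens

namespace Rep

variable {A : Type u} [CStarAlgebra A]

/-! ### Irreducible representations -/

theorem toCLM_continuous (π : Rep.{u, v} A) : Continuous π.hom := π.toCLM.continuous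

/-- The kernel of the image of a central projection is a closed invariant subspace. -/
theorem IsIrreducible.map_eq_zero_or_eq_one {σ : Rep.{u, v} A} (hσ : σ.IsIrreducible) {p : A}
    (hp : IsIdempotentElem p) (hc : ∀ b, Commute p b) : σ.hom p = 0 ∨ σ.hom p = 1 := by
  have hpp (ξ : σ.H) : σ.hom p (σ.hom p ξ) = σ.hom p ξ := by
    rw [← mul_apply_eq_comp, ← map_mul, hp.eq]
  rcases hσ.2 (LinearMap.ker (σ.hom p : σ.H →ₗ[ℂ] σ.H)) (σ.hom p).isClosed_ker
    fun a ξ hξ => by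
      have hξ' : σ.hom p ξ = 0 := hξ
      change σ.hom p (σ.hom a ξ) = 0
      rw [← mul_apply_eq_comp, ← map_mul, (hc a).eq, map_mul,
        mul_apply_eq_comp, hξ', map_zero] with h | h
  · right
    ext ξ
    refine (LinearMap.ker_eq_bot.mp h) ?_
    exact hpp ξ
  · left
    ext ξ
    exact h.ge (Submodule.mem_top : ξ ∈ ⊤)

/-- Burnside's theorem: a finite-dimensional irreducible representation maps onto all operators. -/
theorem IsIrreducible.surjective {π : Rep.{u, v} A} (hπ : π.IsIrreducible)
    [FiniteDimensional ℂ π.H] : Function.Surjective π.hom := by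
  intro T
  let : Module A π.H := Module.compHom π.H
    ((ContinuousLinearMap.toLinearMapRingHom (R₁ := ℂ) (M₁ := π.H)).comp
      (π.hom : A →+* (π.H →L[ℂ] π.H)))
  have smul_eq (a : A) (ξ : π.H) : a • ξ = π.hom a ξ := rfl
  have : IsScalarTower ℂ A π.H := ⟨fun c a ξ => by simp [smul_eq]⟩
  have := hπ.1
  have : IsSimpleModule A π.H :=
    { exists_pair_ne := exists_pair_ne _
      eq_bot_or_eq_top := fun K => by
        rcases hπ.2 (K.restrictScalars ℂ) (Submodule.closed_of_finiteDimensional _)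
          fun a ξ hξ => K.smul_mem a hξ with h | h
        · exact .inl ((Submodule.restrictScalars_eq_bot_iff ℂ A π.H).mp h)
        · exact .inr ((Submodule.restrictScalars_eq_top_iff ℂ A π.H).mp h) }
  -- By Schur's lemma the commutant consists of scalars, so `T` is linear over it.
  let f : Module.End (Module.End A π.H) π.H :=
    { toFun := T
      map_add' := map_add T
      map_smul' := fun g ξ => by
        obtain ⟨c, rfl⟩ := (IsSimpleModule.algebraMap_end_bijective_of_isAlgClosed ℂ).2 g
        simp }
  obtain ⟨s, hs⟩ := Module.Finite.fg_top (R := ℂ) (M := π.H)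
  obtain ⟨a, ha⟩ := jacobson_density f s
  refine ⟨a, ?_⟩
  ext ξ
  exact (LinearMap.eqOn_span (f := (π.hom a : π.H →ₗ[ℂ] π.H)) (g := (T : π.H →ₗ[ℂ] π.H))
    (fun η hη => (ha η hη).symm)) (hs.ge (Submodule.mem_top : ξ ∈ ⊤))

open InnerProductSpace in
/-- An irreducible representation that factors through a finite-dimensional irreducible
representation is unitarily equivalent to it: if `q` is sent by `π` to the projection onto a unit
vector `ξ`, and `η` is a unit vector fixed by `σ(q)`, then `π(a)ξ ↦ σ(a)η` is unitary. -/
theorem unitarilyEquivalent_of_weaklyContained {σ : Rep.{u, w} A} {π : Rep.{u, v} A}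
    (hσ : σ.IsIrreducible) (hπ : π.IsIrreducible) [FiniteDimensional ℂ π.H]
    (h : σ.WeaklyContained π) : σ.UnitarilyEquivalent π := by
  have hker {a b : A} (hab : π.hom a = π.hom b) : σ.hom a = σ.hom b := by
    rw [← sub_eq_zero, ← map_sub]
    exact h (show π.hom (a - b) = 0 by rw [map_sub, hab, sub_self])
  choose g hg using hπ.surjective
  have := hσ.1
  let b := stdOrthonormalBasis ℂ π.H
  -- The `σ (g (rankOne b_i b_i))` add up to the identity, so one of them is nonzero.
  obtain ⟨i, hi⟩ : ∃ i, σ.hom (g (rankOne ℂ (b i) (b i))) ≠ 0 := by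
    by_contra! h0
    have h1 : σ.hom (∑ i, g (rankOne ℂ (b i) (b i))) = σ.hom 1 := by
      apply hker
      simp only [map_sum, hg, map_one]
      exact b.sum_rankOne_eq_id
    simp only [map_sum, h0, Finset.sum_const_zero, map_one] at h1
    exact zero_ne_one h1
  set ξ := b i
  have hξ : ‖ξ‖ = 1 := b.orthonormal.1 i
  set q := g (rankOne ℂ ξ ξ) with hq_def
  have hqq (ζ : σ.H) : σ.hom q (σ.hom q ζ) = σ.hom q ζ := by
    rw [← mul_apply_eq_comp, ← map_mul]
    congr 1
    apply hker
    rw [map_mul, hq_def, hg]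
    exact isIdempotentElem_rankOne_self hξ
  obtain ⟨ζ, hζ⟩ : ∃ ζ, σ.hom q ζ ≠ 0 := by
    by_contra! h0
    exact hi (ContinuousLinearMap.ext h0)
  obtain ⟨η, hη, hqη⟩ : ∃ η : σ.H, ‖η‖ = 1 ∧ σ.hom q η = η := by
    refine ⟨((‖σ.hom q ζ‖⁻¹ : ℝ) : ℂ) • σ.hom q ζ, ?_, by simp only [map_smul, hqq]⟩
    simp [norm_smul, inv_mul_cancel₀ (norm_ne_zero_iff.mpr hζ)]
  let V : π.H →ₗ[ℂ] σ.H :=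
    { toFun := fun x => σ.hom (g (rankOne ℂ x ξ)) η
      map_add' := fun x y => by
        rw [← add_apply, ← map_add]
        congr 1
        exact hker (by simp [hg])
      map_smul' := fun c x => by
        rw [RingHom.id_apply, ← smul_apply, ← map_smul]
        congr 1
        exact hker (by simp [hg]) }
  have hV (x : π.H) : ‖V x‖ = ‖x‖ := by
    have h1 : σ.hom (star (g (rankOne ℂ x ξ)) * g (rankOne ℂ x ξ))
        = σ.hom (((‖x‖ : ℂ) ^ 2) • q) := by
      apply hker
      rw [map_mul, map_star, map_smul, hq_def, hg, hg, ContinuousLinearMap.star_eq_adjoint,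
        adjoint_rankOne, ContinuousLinearMap.mul_def, rankOne_comp_rankOne,
        inner_self_eq_norm_sq_to_K]
      rfl
    have h2 : (inner ℂ (V x) (V x) : ℂ) = (‖x‖ : ℂ) ^ 2 := by
      change inner ℂ (σ.hom (g (rankOne ℂ x ξ)) η) (σ.hom (g (rankOne ℂ x ξ)) η) = _
      rw [← ContinuousLinearMap.adjoint_inner_right, ← ContinuousLinearMap.star_eq_adjoint,
        ← map_star, ← mul_apply_eq_comp, ← map_mul, h1, map_smul, smul_apply, hqη,
        inner_smul_right, inner_self_eq_norm_sq_to_K, hη]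
      simp
    rw [inner_self_eq_norm_sq_to_K] at h2
    have h3 : ‖V x‖ ^ 2 = ‖x‖ ^ 2 := by
      apply Complex.ofReal_injective
      push_cast
      exact h2
    exact (pow_left_inj₀ (norm_nonneg _) (norm_nonneg _) two_ne_zero).mp h3
  have hVa (a : A) (x : π.H) : V (π.hom a x) = σ.hom a (V x) := by
    change σ.hom (g (rankOne ℂ (π.hom a x) ξ)) η = σ.hom a (σ.hom (g (rankOne ℂ x ξ)) η)
    rw [← mul_apply_eq_comp, ← map_mul]
    congr 1
    apply hker
    rw [hg, map_mul, hg, ContinuousLinearMap.mul_def, comp_rankOne]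
  let W : π.H →ₗᵢ[ℂ] σ.H := ⟨V, hV⟩
  have hW : LinearMap.range V = ⊤ := by
    refine (hσ.2 (LinearMap.range V) W.isometry.isClosedEmbedding.isClosed_range ?_).resolve_left ?_
    · rintro a _ ⟨x, rfl⟩
      exact ⟨π.hom a x, hVa a x⟩
    · intro h0
      have h1 : V ξ = 0 := by
        have : V ξ ∈ LinearMap.range V := ⟨ξ, rfl⟩
        rwa [h0] at this
      have h2 := hV ξ
      rw [h1, norm_zero, hξ] at h2
      exact zero_ne_one h2
  let U : π.H ≃ₗᵢ[ℂ] σ.H := LinearIsometryEquiv.ofSurjective W (LinearMap.range_eq_top.mp hW)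
  refine ⟨U.symm, fun a x => ?_⟩
  rw [LinearIsometryEquiv.symm_apply_eq]
  change _ = V (π.hom a (U.symm x))
  rw [hVa]
  exact congrArg (σ.hom a) (U.apply_symm_apply x).symm

/-! ### The central projection cut out by the spectral gap -/

/-- An element is determined by its images under `π` and the members of `Δ` that are not weakly
equivalent to `π`. -/
theorem Separating.eq_zero {Δ : Set (Rep.{u, v} A)} (hsep : Separating Δ) {π : Rep.{u, v} A}
    {x : A} (hπx : π.hom x = 0) (hx : ∀ σ ∈ Δ, ¬ σ.WeaklyEquivalent π → σ.hom x = 0) : x = 0 := by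
  apply hsep
  funext ⟨σ, hσ⟩
  change σ.hom x = σ.hom 0
  rw [map_zero]
  by_cases h : σ.WeaklyEquivalent π
  · exact h.1 hπx
  · exact hx σ hσ h

/-- The spectral gap cuts out a central projection `p` of `A` with `ker π = (1 - p) A`, by the
continuous functional calculus of `t`. -/
theorem exists_central_projection {Δ : Set (Rep.{u, v} A)} (hsep : Separating Δ)
    (π : Rep.{u, v} A) (t : A) (ht : IsSelfAdjoint t) (R : ℝ)
    (hR : R ∈ lowerBounds (spectrum ℝ (π.hom t)))
    (hgap : sSup {r : ℝ | ∃ σ ∈ Δ, ¬ σ.WeaklyEquivalent π ∧ r = ‖σ.hom t‖} < R) :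
    ∃ p : A, IsStarProjection p ∧ (∀ b, Commute p b) ∧ π.hom p = 1 ∧
      ∀ x, π.hom x = 0 → p * x = 0 := by
  set S := {r : ℝ | ∃ σ ∈ Δ, ¬ σ.WeaklyEquivalent π ∧ r = ‖σ.hom t‖}
  have hbdd : BddAbove S := by
    refine ⟨‖t‖, ?_⟩
    rintro _ ⟨σ, -, -, rfl⟩
    exact NonUnitalStarAlgHom.norm_apply_le σ.hom t
  -- The piecewise linear function that is `0` up to `sSup S` and `1` from `R` on.
  let f : ℝ → ℝ := fun x => max 0 (min 1 ((x - sSup S) / (R - sSup S)))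
  have hf : Continuous f := by fun_prop
  have hpos : 0 < R - sSup S := sub_pos.mpr hgap
  have hf0 {x : ℝ} (hx : x ≤ sSup S) : f x = 0 :=
    max_eq_left ((min_le_right _ _).trans
      (div_nonpos_of_nonpos_of_nonneg (sub_nonpos.mpr hx) hpos.le))
  have hf1 {x : ℝ} (hx : R ≤ x) : f x = 1 := by
    have : 1 ≤ (x - sSup S) / (R - sSup S) := (one_le_div hpos).mpr (by linarith)
    simp [f, min_eq_left this]
  have hmap (σ : Rep.{u, v} A) : σ.hom (cfc f t) = cfc f (σ.hom t) :=
    σ.hom.map_cfc f t hf.continuousOn σ.toCLM_continuous ht (ht.map σ.hom)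
  set p := cfc f t
  have hπp : π.hom p = 1 := by
    rw [hmap, cfc_congr (g := fun _ => 1) fun x hx => hf1 (hR hx)]
    exact cfc_const_one ℝ _ (ht.map π.hom)
  have hσp (σ : Rep.{u, v} A) (hσ : σ ∈ Δ) (hσπ : ¬ σ.WeaklyEquivalent π) : σ.hom p = 0 := by
    rw [hmap, cfc_congr (g := fun _ => 0) fun x hx => hf0 ?_]
    · exact cfc_const_zero ℝ _
    · rcases subsingleton_or_nontrivial (σ.H →L[ℂ] σ.H) with _ | _
      · simp [spectrum.of_subsingleton] at hx
      · exact (le_abs_self x).trans ((spectrum.norm_le_norm_of_mem hx).trans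
          (le_csSup hbdd ⟨σ, hσ, hσπ, rfl⟩))
  refine ⟨p, ⟨?_, cfc_predicate f t⟩, fun b => ?_, hπp, fun x hx => ?_⟩
  · refine sub_eq_zero.mp (hsep.eq_zero (π := π) ?_ fun σ hσ hσπ => ?_)
    · simp [hπp]
    · simp [hσp σ hσ hσπ]
  · refine sub_eq_zero.mp (hsep.eq_zero (π := π) ?_ fun σ hσ hσπ => ?_)
    · simp [hπp]
    · simp [hσp σ hσ hσπ]
  · refine hsep.eq_zero (π := π) ?_ fun σ hσ hσπ => ?_
    · simp [hx]
    · simp [hσp σ hσ hσπ]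

/-! ### The support projection -/

/-- If `π` is finite-dimensional, the functionals vanishing on `ker π` are those of the form
`ψ ∘ π`. -/
theorem exists_comp_toCLM_eq (π : Rep.{u, v} A) [FiniteDimensional ℂ π.H] (φ : StrongDual ℂ A)
    (hφ : ∀ a, π.hom a = 0 → φ a = 0) :
    ∃ ψ : StrongDual ℂ (π.H →L[ℂ] π.H), ψ.comp π.toCLM = φ := by
  let T : A →ₗ[ℂ] (π.H →L[ℂ] π.H) := π.toCLM
  obtain ⟨ψ, hψ⟩ : (φ : A →ₗ[ℂ] ℂ) ∈ LinearMap.range T.dualMap := by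
    rw [LinearMap.range_dualMap_eq_dualAnnihilator_ker, Submodule.mem_dualAnnihilator]
    exact hφ
  exact ⟨LinearMap.toContinuousLinearMap ψ, by ext a; exact LinearMap.congr_fun hψ a⟩

/-- If a central projection `p` of `A` satisfies `ker π = (1 - p) A`, then `p` is the one and only
support projection of `π`. -/
theorem isSupportProjection_toBidual (π : Rep.{u, v} A) [FiniteDimensional ℂ π.H] {p : A}
    (hp : IsStarProjection p) (hc : ∀ b, Commute p b) (hπp : π.hom p = 1)
    (hker : ∀ x, π.hom x = 0 → p * x = 0) (s : Bidual A) :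
    π.IsSupportProjection s ↔ s = toBidual A p := by
  have he : IsStarProjection (toBidual A (1 - p)) := isStarProjection_toBidual hp.one_sub
  have hec (x : Bidual A) : Commute (toBidual A (1 - p)) x :=
    commute_toBidual (fun b => (Commute.one_left b).sub_left (hc b)) x
  have hrange : Set.range (fun x : Bidual A => toBidual A (1 - p) * x)
      = {x : Bidual A | secondAdjoint π.toCLM x = 0} := by
    ext x
    constructor
    · rintro ⟨y, rfl⟩
      change secondAdjoint π.toCLM (toBidual A (1 - p) * y) = 0
      ext ψ
      change y ((ψ.comp π.toCLM).comp (ContinuousLinearMap.mul ℂ A (1 - p))) = 0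
      have : (ψ.comp π.toCLM).comp (ContinuousLinearMap.mul ℂ A (1 - p)) = 0 := by
        ext a
        simp [toCLM_apply, hπp]
      rw [this, map_zero]
    · intro hx
      refine ⟨x, ?_⟩
      have h0 : toBidual A p * x = 0 := by
        ext φ
        rw [toBidual_mul_apply]
        obtain ⟨ψ, hψ⟩ := π.exists_comp_toCLM_eq (φ.comp (ContinuousLinearMap.mul ℂ A p))
          fun a ha => by simp [hker a ha]
        rw [← hψ]
        exact congrArg (fun z : Bidual (π.H →L[ℂ] π.H) => z ψ) hx
      change toBidual A (1 - p) * x = x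
      rw [toBidual_one_sub_mul, h0]
      exact sub_zero x
  constructor
  · rintro ⟨e, h1, h2, h3, rfl⟩
    rw [bidual_idempotent_ext h1.isIdempotentElem he.isIdempotentElem (h2 _) (h3.trans hrange.symm),
      map_sub, sub_sub_cancel]
  · rintro rfl
    exact ⟨toBidual A (1 - p), he, hec, hrange, by rw [map_sub, sub_sub_cancel]⟩

theorem peaksStrongly_of_central_projection {π : Rep.{u, v} A} (hπ : π.IsIrreducible)
    [FiniteDimensional ℂ π.H] {p : A} (hp : IsIdempotentElem p) (hc : ∀ b, Commute p b)
    (hπp : π.hom p = 1) (hker : ∀ x, π.hom x = 0 → p * x = 0) : PeaksStrongly.{u, v, w} p π := by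
  have := hπ.1
  have hnorm : ‖π.hom p‖ = 1 := by rw [hπp, norm_one]
  rw [PeaksStrongly, hnorm]
  refine (Real.sSup_nonpos ?_).trans_lt one_pos
  rintro _ ⟨σ, hσ, hσπ, rfl⟩
  rcases hσ.map_eq_zero_or_eq_one hp hc with h | h
  · rw [h, norm_zero]
  · refine absurd (unitarilyEquivalent_of_weaklyContained hσ hπ fun x hx => ?_) hσπ
    change σ.hom x = 0
    rw [← one_mul (σ.hom x), ← h, ← map_mul, hker x hx, map_zero]

end Rep

end CStarPeak

theorem theorem3p13 {A : Type u} [CStarAlgebra A] [PartialOrder A] [StarOrderedRing A]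
    (Δ : Set (CStarPeak.Rep.{u, v} A))
    (hirr : ∀ σ ∈ Δ, σ.IsIrreducible)
    (hsep : CStarPeak.Rep.Separating Δ)
    (π : CStarPeak.Rep.{u, v} A) (hπ : π ∈ Δ) (hfin : FiniteDimensional ℂ π.H)
    (t : A) (ht : 0 ≤ t)
    (R : ℝ) (hR : IsLeast (spectrum ℝ (π.hom t)) R)
    (hgap : sSup {r : ℝ | ∃ σ ∈ Δ, ¬ σ.WeaklyEquivalent π ∧ r = ‖σ.hom t‖} < R) :
    ∃ p : A,
      (∀ s : CStarPeak.Bidual A, π.IsSupportProjection s ↔ s = CStarPeak.toBidual A p) ∧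
      CStarPeak.Rep.PeaksStrongly.{u, v, w} p π := by
  obtain ⟨p, hp, hc, hπp, hker⟩ := CStarPeak.Rep.exists_central_projection hsep π t
    (IsSelfAdjoint.of_nonneg ht) R hR.2 hgap
  exact ⟨p, π.isSupportProjection_toBidual hp hc hπp hker,
    CStarPeak.Rep.peaksStrongly_of_central_projection (hirr π hπ) hp.isIdempotentElem hc hπp hker⟩
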